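/- \textbf{Lemma.} Let $\sigma=(\sigma_1,\sigma_2,\sigma_3)$ be the Pauli matrices, $\mathbf p=-i\nabla$, and let $\mathbf A:\mathbb R^3\to\mathbb R^3$ be a vector field. Suppose that there are constants $\alpha>0$, $r_1>0$ and $C_A\in\mathbb R$ such that $$|\mathbf A(x)|\le C_A|x|^{-1-\alpha}\qquad\text{for almost every }x\in\mathbb R^3\text{ with }|x|\ge r_1 .$$ Let $2\le p<\infty$ and let $g\in W^{1,2}_{\mathrm{loc}}(\mathbb R^3;\mathbb C^2)\cap L^p(\mathbb R^3;\mathbb C^2)$ satisfy $$\sigma\cdot(\mathbf p-\mathbf A)g=\sum_{j=1}^{3}\sigma_j\bigl(-i\,\partial_j g-A_j g\bigr)=0\qquad\text{almost everywhere on }\mathbb R^3,$$ where $\partial_j g$ are the weak derivatives of $g$. Then $g\in L^2(\mathbb R^3;\mathbb C^2)$. -/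

import Mathlib

open MeasureTheory
open scoped ENNReal

/-- The Euclidean space `ℝ³`. -/
abbrev Space3 : Type := EuclideanSpace ℝ (Fin 3)

/-- The space `ℂ²` of two-component spinors, with its Hermitian norm. -/
abbrev Spinor : Type := EuclideanSpace ℂ (Fin 2)

/-- The Pauli matrices `σ₁, σ₂, σ₃`. -/
noncomputable def pauliMatrix : Fin 3 → Matrix (Fin 2) (Fin 2) ℂ :=
  ![!![0, 1; 1, 0], !![0, -Complex.I; Complex.I, 0], !![1, 0; 0, -1]]

/-- `σ · v = ∑ⱼ σⱼ vⱼ` for a triple `v` of spinors. -/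
noncomputable def sigmaDot (v : Fin 3 → Spinor) : Spinor :=
  ∑ j, Matrix.toEuclideanLin (pauliMatrix j) (v j)

/-- `f` belongs to `L²_loc(ℝ³, ℂ²)`. -/
def MemL2Loc (f : Space3 → Spinor) : Prop :=
  ∀ S : Set Space3, IsCompact S → MemLp f 2 (volume.restrict S)

/-- `h` is the weak partial derivative `∂ⱼ f` on `ℝ³`: integration by parts holds against every
test function in `C_c^∞(ℝ³)`. -/
structure IsWeakPartialDeriv (j : Fin 3) (f h : Space3 → Spinor) : Prop where
  locallyIntegrable : LocallyIntegrable f volume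
  locallyIntegrable_deriv : LocallyIntegrable h volume
  integral_eq : ∀ φ : Space3 → ℝ, ContDiff ℝ (⊤ : ℕ∞) φ → HasCompactSupport φ →
    ∫ x, fderiv ℝ φ x (EuclideanSpace.single j 1) • f x = - ∫ x, φ x • h x

/-- `h = (h 0, h 1, h 2)` is the weak gradient of `f`. -/
def IsWeakGradient (f : Space3 → Spinor) (h : Fin 3 → Space3 → Spinor) : Prop :=
  ∀ j, IsWeakPartialDeriv j f (h j)

/-- `f` belongs to `W^{1,2}_loc(ℝ³, ℂ²)`. -/
def MemW12Loc (f : Space3 → Spinor) : Prop :=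
  MemL2Loc f ∧ ∃ h : Fin 3 → Space3 → Spinor, IsWeakGradient f h ∧ ∀ j, MemL2Loc (h j)

/-- `g` has a weak gradient and `σ · (p - A) g = 0` almost everywhere on `ℝ³`, with `p = -i∇`.
Weak gradients are unique almost everywhere, so the choice of `h` is immaterial. -/
def SolvesPauliEquation (A : Space3 → Space3) (g : Space3 → Spinor) : Prop :=
  ∃ h : Fin 3 → Space3 → Spinor, IsWeakGradient g h ∧
    ∀ᵐ x, sigmaDot (fun j => (-Complex.I) • h j x - (A x j : ℂ) • g x) = 0

/-! The equation says that the Dirac derivative of `g` is `σ·A g` up to a phase, hence at most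
`3C|y|^(-1-α)|g(y)|` far out. The Dirac operator has a fundamental solution of size `|z|^(-2)`, so a
cut-off copy of `g` is bounded pointwise by the Riesz potential of its Dirac derivative
(`exists_ae_enorm_smul_le`). The outer cutoff at radius `L` contributes `O(L^(-3/p))` because `g ∈
L^p`, and the limit `L → ∞` leaves `|g(x)| ≤ D ∫_{|y|≥r} |x-y|^(-2) |y|^(-1-α) |g(y)| dy` for `|x| ≥
2r` (`exists_ae_enorm_le_riesz`).

The Riesz potential maps `L²(|x|^(2a+2) dx)` to `L²(|x|^(2a) dx)` for `-3/2 < a < 1/2`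
(`exists_lintegral_weighted_riesz_le`). Inserted in the integral inequality, this improves the
weight exponent of `g` by `α` (`exteriorEnergy_lt_top_of_le`). For `p > 2` the `L^p` hypothesis
supplies a starting exponent in `(-3/2, 0)`, and finitely many improvements reach `0`, which is
square integrability at infinity. Inside a ball, `g` is in `L²` by assumption. -/

open Metric Filter Topology

/-! ### Powers of the norm and their Riesz potentials -/

/-- The power `‖x‖ ^ r` of the norm, as an extended nonnegative real. -/
noncomputable def normPow (r : ℝ) (x : Space3) : ℝ≥0∞ := ENNReal.ofReal (‖x‖ ^ r)

@[fun_prop]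
theorem measurable_normPow (r : ℝ) : Measurable (normPow r) := by
  unfold normPow; fun_prop

theorem normPow_mul (r s : ℝ) {x : Space3} (hx : 0 < ‖x‖) :
    normPow r x * normPow s x = normPow (r + s) x := by
  unfold normPow
  rw [← ENNReal.ofReal_mul (by positivity), Real.rpow_add hx]

theorem normPow_pow_two (r : ℝ) (x : Space3) : normPow r x ^ 2 = normPow (2 * r) x := by
  unfold normPow
  rw [← ENNReal.ofReal_pow (by positivity), ← Real.rpow_natCast, ← Real.rpow_mul (by positivity),
    mul_comm]
  norm_num

theorem normPow_sub_comm (r : ℝ) (x y : Space3) : normPow r (x - y) = normPow r (y - x) := by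
  unfold normPow; rw [norm_sub_rev]

theorem normPow_smul (r : ℝ) {c : ℝ} (hc : 0 ≤ c) (x : Space3) :
    normPow r (c • x) = ENNReal.ofReal (c ^ r) * normPow r x := by
  unfold normPow
  rw [norm_smul, Real.norm_of_nonneg hc, Real.mul_rpow hc (by positivity),
    ENNReal.ofReal_mul (by positivity)]

theorem normPow_le_of_nonpos {r : ℝ} (hr : r ≤ 0) {c : ℝ} (hc : 0 < c) {x : Space3}
    (hx : c ≤ ‖x‖) : normPow r x ≤ ENNReal.ofReal (c ^ r) :=
  ENNReal.ofReal_le_ofReal (Real.rpow_le_rpow_of_nonpos hc hx hr)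

theorem lintegral_normPow_ball_lt_top {b : ℝ} (hb : b < 3) (R : ℝ) :
    ∫⁻ x in ball (0 : Space3) R, normPow (-b) x < ∞ := by
  have h : IntegrableOn (fun x : Space3 => ‖x‖ ^ (-b)) (ball 0 R) volume := by
    refine integrableOn_ball_of_norm_le_rpow (C := 1) (α := b) (by simp) (by simpa using hb)
      (ae_of_all _ fun x => ?_)
      (measurable_norm.pow_const (-b)).aestronglyMeasurable
    rw [Real.norm_of_nonneg (by positivity), one_mul]
  exact h.lintegral_lt_top

theorem lintegral_normPow_compl_ball_lt_top {b : ℝ} (hb : 3 < b) {R : ℝ} (hR : 0 < R) :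
    ∫⁻ x in {x : Space3 | R ≤ ‖x‖}, normPow (-b) x < ∞ := by
  have h := (integrable_one_add_norm (E := Space3) (μ := volume) (r := b)
    (by simpa using hb)).const_mul ((1 / R + 1) ^ b)
  refine lt_of_le_of_lt (lintegral_mono_ae ?_) h.integrableOn.lintegral_lt_top
  filter_upwards [ae_restrict_mem (measurableSet_le measurable_const measurable_norm)] with x hx
  have hx : R ≤ ‖x‖ := hx
  have hx0 : 0 < ‖x‖ := hR.trans_le hx
  refine ENNReal.ofReal_le_ofReal ?_
  have h1 : 1 + ‖x‖ ≤ (1 / R + 1) * ‖x‖ := by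
    have : 1 ≤ 1 / R * ‖x‖ := by rw [one_div_mul_eq_div, one_le_div hR]; exact hx
    linarith
  calc ‖x‖ ^ (-b) = (1 / R + 1) ^ b * ((1 / R + 1) * ‖x‖) ^ (-b) := by
        rw [Real.mul_rpow (by positivity) (by positivity), ← mul_assoc,
          ← Real.rpow_add (by positivity)]
        simp
    _ ≤ _ := by
        gcongr ?_ * ?_
        exact Real.rpow_le_rpow_of_nonpos (by positivity) h1 (by linarith)

theorem lintegral_comp_smul_space3 {c : ℝ} (hc : 0 < c) (f : Space3 → ℝ≥0∞) :
    ∫⁻ x, f x = ENNReal.ofReal (c ^ 3) * ∫⁻ x, f (c • x) := by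
  have h1 : ∫⁻ x, f (c • x) = ∫⁻ y, f y ∂(Measure.map (fun x : Space3 => c • x) volume) :=
    (lintegral_map_equiv f
      (Homeomorph.smul (isUnit_iff_ne_zero.2 hc.ne').unit).toMeasurableEquiv).symm
  rw [h1, Measure.map_addHaar_smul volume hc.ne', lintegral_smul_measure, smul_eq_mul, ← mul_assoc,
    ← ENNReal.ofReal_mul (by positivity)]
  have : c ^ 3 * |(c ^ Module.finrank ℝ Space3)⁻¹| = 1 := by
    rw [finrank_euclideanSpace_fin, abs_of_pos (by positivity), mul_inv_cancel₀ (by positivity)]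
  rw [this]; simp

/-- Three regions: `w` near `0`, `w` near `e`, and `w` away from both. In the last, `‖w‖ ≤ ‖e - w‖ +
1 ≤ 3‖e - w‖`, so the kernel costs a factor `9` and the product decays like `‖w‖^(-(b+2))`. -/
theorem normPow_mul_normPow_le {b : ℝ} (hb : 0 ≤ b) {e : Space3} (he : ‖e‖ = 1) (w : Space3) :
    normPow (-2) (e - w) * normPow (-b) w ≤
      ENNReal.ofReal 4 * (ball (0 : Space3) 1).indicator (normPow (-b)) w +
      ENNReal.ofReal (2 ^ b) * (ball (0 : Space3) 1).indicator (normPow (-2)) (e - w) +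
      ENNReal.ofReal 9 * {x : Space3 | 1 / 2 ≤ ‖x‖}.indicator (normPow (-(b + 2))) w := by
  have tri : 1 ≤ ‖e - w‖ + ‖w‖ := by rw [← he]; simpa using norm_add_le (e - w) w
  rcases lt_or_ge ‖w‖ (1 / 2) with h | h
  · refine le_add_right (le_add_right ?_)
    rw [Set.indicator_of_mem (by simp; linarith)]
    gcongr
    refine (normPow_le_of_nonpos (c := 1 / 2) (by norm_num) (by norm_num) (by linarith)).trans ?_
    refine ENNReal.ofReal_le_ofReal ?_
    rw [show (-2 : ℝ) = -((2 : ℕ) : ℝ) by norm_num, Real.rpow_neg (by norm_num), Real.rpow_natCast]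
    norm_num
  · rcases lt_or_ge ‖e - w‖ (1 / 2) with h' | h'
    · refine le_add_right (le_add_left ?_)
      rw [Set.indicator_of_mem (by simp; linarith), mul_comm]
      gcongr
      refine (normPow_le_of_nonpos (c := 1 / 2) (by linarith) (by norm_num) h).trans ?_
      refine ENNReal.ofReal_le_ofReal ?_
      rw [Real.rpow_neg (by norm_num), one_div, Real.inv_rpow (by norm_num), inv_inv]
    · refine le_add_left ?_
      rw [Set.indicator_of_mem (by simpa using h), neg_add, add_comm,
        ← normPow_mul _ _ (by linarith), ← mul_assoc]
      gcongr
      have h3 : ‖w‖ / 3 ≤ ‖e - w‖ := by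
        have : ‖w‖ ≤ ‖e - w‖ + ‖e‖ := by
          rw [norm_sub_rev]; simpa using norm_add_le (w - e) e
        linarith
      unfold normPow
      rw [← ENNReal.ofReal_mul (by norm_num)]
      refine ENNReal.ofReal_le_ofReal ?_
      refine (Real.rpow_le_rpow_of_nonpos (x := ‖w‖ / 3) (by linarith) h3 (by norm_num)).trans ?_
      rw [div_eq_mul_inv, Real.mul_rpow (by positivity) (by norm_num), mul_comm]
      gcongr
      rw [show (-2 : ℝ) = -((2 : ℕ) : ℝ) by norm_num, Real.rpow_neg (by norm_num),
        Real.rpow_natCast]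
      norm_num

/-- Scaling by `‖x‖` reduces to a unit vector and produces the power `3 - 2 - b = 1 - b`. The bound
there does not depend on the unit vector, by translation invariance. Integrability at the origin
needs `b < 3`, and at infinity `b + 2 > 3`. -/
theorem exists_lintegral_riesz_le {b : ℝ} (hb : 1 < b) (hb3 : b < 3) :
    ∃ M : ℝ≥0∞, M ≠ ∞ ∧ ∀ x : Space3, x ≠ 0 →
      ∫⁻ y, normPow (-2) (x - y) * normPow (-b) y ≤ M * normPow (1 - b) x := by
  refine ⟨ENNReal.ofReal 4 * (∫⁻ w in ball (0 : Space3) 1, normPow (-b) w) +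
      ENNReal.ofReal (2 ^ b) * (∫⁻ w in ball (0 : Space3) 1, normPow (-2) w) +
      ENNReal.ofReal 9 * (∫⁻ w in {x : Space3 | 1 / 2 ≤ ‖x‖}, normPow (-(b + 2)) w), ?_, ?_⟩
  · have h1 := (lintegral_normPow_ball_lt_top hb3 1).ne
    have h2 := (lintegral_normPow_ball_lt_top (b := 2) (by norm_num) 1).ne
    have h3 := (lintegral_normPow_compl_ball_lt_top (b := b + 2) (by linarith)
      (R := 1 / 2) (by norm_num)).ne
    finiteness
  · intro x hx
    have hx' : 0 < ‖x‖ := norm_pos_iff.2 hx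
    set e : Space3 := ‖x‖⁻¹ • x with hedef
    have he : ‖e‖ = 1 := by rw [hedef, norm_smul, norm_inv, norm_norm, inv_mul_cancel₀ hx'.ne']
    have hxe : x = ‖x‖ • e := by rw [hedef, smul_smul, mul_inv_cancel₀ hx'.ne', one_smul]
    have key : ∀ w : Space3, normPow (-2) (x - ‖x‖ • w) * normPow (-b) (‖x‖ • w) =
        ENNReal.ofReal (‖x‖ ^ (-2 - b)) * (normPow (-2) (e - w) * normPow (-b) w) := by
      intro w
      have : x - ‖x‖ • w = ‖x‖ • (e - w) := by rw [smul_sub, ← hxe]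
      rw [this, normPow_smul _ hx'.le, normPow_smul _ hx'.le, sub_eq_add_neg (-2) b,
        Real.rpow_add hx', ENNReal.ofReal_mul (by positivity)]
      ring
    rw [lintegral_comp_smul_space3 hx']
    simp_rw [key]
    rw [lintegral_const_mul _ (by fun_prop), ← mul_assoc, ← ENNReal.ofReal_mul (by positivity),
      mul_comm]
    have : ENNReal.ofReal (‖x‖ ^ 3 * ‖x‖ ^ (-2 - b)) = normPow (1 - b) x := by
      unfold normPow
      rw [← Real.rpow_natCast, ← Real.rpow_add hx']
      congr 2; push_cast; ring
    rw [this]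
    gcongr
    refine (lintegral_mono (normPow_mul_normPow_le (by linarith) he)).trans ?_
    have hs : MeasurableSet {x : Space3 | 1 / 2 ≤ ‖x‖} :=
      measurableSet_le measurable_const measurable_norm
    have m1 : Measurable ((ball (0 : Space3) 1).indicator (normPow (-b))) :=
      (measurable_normPow _).indicator measurableSet_ball
    have m2 : Measurable ((ball (0 : Space3) 1).indicator (normPow (-2))) :=
      (measurable_normPow _).indicator measurableSet_ball
    have m3 : Measurable ({x : Space3 | 1 / 2 ≤ ‖x‖}.indicator (normPow (-(b + 2)))) :=
      (measurable_normPow _).indicator hs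
    rw [lintegral_add_left (by fun_prop), lintegral_add_left (by fun_prop),
      lintegral_const_mul _ m1, lintegral_const_mul _ (by fun_prop), lintegral_const_mul _ m3,
      lintegral_indicator measurableSet_ball, lintegral_indicator hs,
      lintegral_sub_left_eq_self (fun w => (ball (0 : Space3) 1).indicator (normPow (-2)) w) e,
      lintegral_indicator measurableSet_ball]

/-! ### Schur's test with power weights -/

theorem sq_lintegral_mul_le {X : Type*} [MeasurableSpace X] {μ : Measure X}
    {k w w' f : X → ℝ≥0∞} (hk : Measurable k) (hw : Measurable w) (hw' : Measurable w')
    (hf : AEMeasurable f μ) (hww' : ∀ᵐ x ∂μ, w x * w' x = 1) :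
    (∫⁻ x, k x * f x ∂μ) ^ 2 ≤ (∫⁻ x, k x * w x ∂μ) * ∫⁻ x, k x * w' x * f x ^ 2 ∂μ := by
  have h := ENNReal.lintegral_mul_le_Lp_mul_Lq μ Real.HolderConjugate.two_two
    (f := fun x => (k x * w x) ^ (1 / 2 : ℝ)) (g := fun x => (k x * w' x) ^ (1 / 2 : ℝ) * f x)
    (by fun_prop) (by fun_prop)
  have e1 : ∫⁻ x, k x * f x ∂μ = ∫⁻ x, ((fun x => (k x * w x) ^ (1 / 2 : ℝ)) *
      fun x => (k x * w' x) ^ (1 / 2 : ℝ) * f x) x ∂μ := by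
    refine lintegral_congr_ae ?_
    filter_upwards [hww'] with x hx
    simp only [Pi.mul_apply]
    rw [← mul_assoc, ← ENNReal.mul_rpow_of_nonneg _ _ (by norm_num),
      show k x * w x * (k x * w' x) = k x ^ (2 : ℝ) * (w x * w' x) by
        rw [ENNReal.rpow_two]; ring, hx, mul_one, ← ENNReal.rpow_mul]
    norm_num
  have sq : ∀ t : ℝ≥0∞, (t ^ (1 / 2 : ℝ)) ^ (2 : ℝ) = t := fun t => by
    rw [← ENNReal.rpow_mul]; norm_num
  rw [← e1] at h
  simp only [ENNReal.mul_rpow_of_nonneg _ _ (zero_le_two : (0 : ℝ) ≤ 2), sq] at h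
  calc (∫⁻ x, k x * f x ∂μ) ^ 2 = (∫⁻ x, k x * f x ∂μ) ^ (2 : ℝ) := (ENNReal.rpow_two _).symm
    _ ≤ _ := ENNReal.rpow_le_rpow h zero_le_two
    _ = _ := by
      rw [ENNReal.mul_rpow_of_nonneg _ _ zero_le_two, sq, sq]
      simp only [ENNReal.rpow_two]

/-- A weighted `L²` bound for the Riesz potential of order one, by Schur's test. -/
theorem exists_lintegral_weighted_riesz_le {a : ℝ} (ha : -3 / 2 < a) (ha' : a < 1 / 2) {r : ℝ}
    (hr : 0 < r) :
    ∃ M : ℝ≥0∞, M ≠ ∞ ∧ ∀ f : Space3 → ℝ≥0∞, AEMeasurable f volume →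
      ∫⁻ x in {x | r ≤ ‖x‖}, normPow (2 * a) x *
          (∫⁻ y in {y | r ≤ ‖y‖}, normPow (-2) (x - y) * f y) ^ 2 ≤
        M * ∫⁻ y in {y | r ≤ ‖y‖}, normPow (2 * a + 2) y * f y ^ 2 := by
  -- Cauchy–Schwarz with weight `|y|^(-s)` needs both `s` and `s - 1 - 2a` in `(1, 3)`. Such `s`
  -- exist exactly when `-3/2 < a < 1/2`, and `s = a + 5/2` is the midpoint of the admissible range.
  obtain ⟨M₁, hM₁, h₁⟩ := exists_lintegral_riesz_le (b := a + 5 / 2) (by linarith) (by linarith)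
  obtain ⟨M₂, hM₂, h₂⟩ := exists_lintegral_riesz_le (b := 3 / 2 - a) (by linarith) (by linarith)
  refine ⟨M₁ * M₂, by finiteness, fun f hf => ?_⟩
  set S : Set Space3 := {x | r ≤ ‖x‖}
  have hS : MeasurableSet S := measurableSet_le measurable_const measurable_norm
  have hpos : ∀ x ∈ S, 0 < ‖x‖ := fun x hx => hr.trans_le hx
  have step : ∀ x ∈ S, normPow (2 * a) x * (∫⁻ y in S, normPow (-2) (x - y) * f y) ^ 2 ≤
      M₁ * ∫⁻ y in S, normPow (a - 3 / 2) x *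
        (normPow (-2) (x - y) * normPow (a + 5 / 2) y * f y ^ 2) := by
    intro x hx
    have hcs := sq_lintegral_mul_le (μ := volume.restrict S) (k := fun y => normPow (-2) (x - y))
      (w := normPow (-(a + 5 / 2))) (w' := normPow (a + 5 / 2)) (f := f) (by fun_prop)
      (by fun_prop) (by fun_prop) hf.restrict (by
        filter_upwards [ae_restrict_mem hS] with y hy
        rw [normPow_mul _ _ (hpos y hy)]; simp [normPow])
    have hle : ∫⁻ y in S, normPow (-2) (x - y) * normPow (-(a + 5 / 2)) y ≤
        M₁ * normPow (1 - (a + 5 / 2)) x :=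
      (setLIntegral_le_lintegral _ _).trans (h₁ x (norm_pos_iff.1 (hpos x hx)))
    have m : AEMeasurable (fun y => normPow (-2) (x - y) * normPow (a + 5 / 2) y * f y ^ 2)
        (volume.restrict S) := by
      have := hf.restrict (s := S); fun_prop
    calc normPow (2 * a) x * (∫⁻ y in S, normPow (-2) (x - y) * f y) ^ 2
        ≤ normPow (2 * a) x * (M₁ * normPow (1 - (a + 5 / 2)) x *
          ∫⁻ y in S, normPow (-2) (x - y) * normPow (a + 5 / 2) y * f y ^ 2) := by
          gcongr; exact hcs.trans (by gcongr)
      _ = M₁ * ((normPow (2 * a) x * normPow (1 - (a + 5 / 2)) x) *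
          ∫⁻ y in S, normPow (-2) (x - y) * normPow (a + 5 / 2) y * f y ^ 2) := by ring
      _ = _ := by
          rw [normPow_mul _ _ (hpos x hx), lintegral_const_mul'' _ m,
            show 2 * a + (1 - (a + 5 / 2)) = a - 3 / 2 by ring]
  have step2 : ∀ y ∈ S, ∫⁻ x in S, normPow (a - 3 / 2) x *
        (normPow (-2) (x - y) * normPow (a + 5 / 2) y * f y ^ 2) ≤
      M₂ * (normPow (2 * a + 2) y * f y ^ 2) := by
    intro y hy
    have e : ∀ x, normPow (a - 3 / 2) x *
        (normPow (-2) (x - y) * normPow (a + 5 / 2) y * f y ^ 2) =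
        (normPow (-2) (y - x) * normPow (-(3 / 2 - a)) x) *
          (normPow (a + 5 / 2) y * f y ^ 2) := by
      intro x
      rw [normPow_sub_comm, neg_sub]; ring
    simp_rw [e]
    rw [lintegral_mul_const _ (by fun_prop)]
    calc _ ≤ (M₂ * normPow (1 - (3 / 2 - a)) y) * (normPow (a + 5 / 2) y * f y ^ 2) := by
          gcongr
          exact (setLIntegral_le_lintegral _ _).trans (h₂ y (norm_pos_iff.1 (hpos y hy)))
      _ = M₂ * ((normPow (1 - (3 / 2 - a)) y * normPow (a + 5 / 2) y) * f y ^ 2) := by ring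
      _ = _ := by
          rw [normPow_mul _ _ (hpos y hy),
            show 1 - (3 / 2 - a) + (a + 5 / 2) = 2 * a + 2 by ring]
  have hmeas : AEMeasurable (Function.uncurry fun x y : Space3 => normPow (a - 3 / 2) x *
        (normPow (-2) (x - y) * normPow (a + 5 / 2) y * f y ^ 2))
      ((volume.restrict S).prod (volume.restrict S)) := by
    have h1 : AEMeasurable (fun z : Space3 × Space3 => f z.2)
        ((volume.restrict S).prod (volume.restrict S)) := hf.restrict.comp_snd
    have h2 : Measurable (fun z : Space3 × Space3 => normPow (a - 3 / 2) z.1) := by fun_prop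
    have h3 : Measurable (fun z : Space3 × Space3 =>
      normPow (-2) (z.1 - z.2) * normPow (a + 5 / 2) z.2) := by fun_prop
    exact h2.aemeasurable.mul (h3.aemeasurable.mul (h1.pow_const 2))
  have swap := lintegral_lintegral_swap hmeas
  refine (setLIntegral_mono' hS step).trans ?_
  rw [lintegral_const_mul' _ _ hM₁, swap, mul_assoc, ← lintegral_const_mul' _ _ hM₂]
  exact mul_le_mul_right (setLIntegral_mono' hS step2) _

/-! ### Pauli algebra -/

/-- The Pauli matrices as continuous linear maps. -/
noncomputable def pauliCLM (j : Fin 3) : Spinor →L[ℂ] Spinor :=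
  LinearMap.toContinuousLinearMap (Matrix.toEuclideanLin (pauliMatrix j))

theorem sigmaDot_eq_sum_pauliCLM (v : Fin 3 → Spinor) : sigmaDot v = ∑ j, pauliCLM j (v j) := rfl

theorem pauliCLM_zero_apply (v : Spinor) : pauliCLM 0 v = !₂[v 1, v 0] := by
  ext i; fin_cases i <;> simp [pauliCLM, pauliMatrix, Matrix.toLpLin_apply, dotProduct]

theorem pauliCLM_one_apply (v : Spinor) :
    pauliCLM 1 v = !₂[-Complex.I * v 1, Complex.I * v 0] := by
  ext i; fin_cases i <;> simp [pauliCLM, pauliMatrix, Matrix.toLpLin_apply, dotProduct]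

theorem pauliCLM_two_apply (v : Spinor) : pauliCLM 2 v = !₂[v 0, -v 1] := by
  ext i; fin_cases i <;> simp [pauliCLM, pauliMatrix, Matrix.toLpLin_apply, dotProduct]

theorem norm_pauliCLM_apply (j : Fin 3) (v : Spinor) : ‖pauliCLM j v‖ = ‖v‖ := by
  fin_cases j
  · simp [pauliCLM_zero_apply, EuclideanSpace.norm_eq, Fin.sum_univ_two, add_comm]
  · simp [pauliCLM_one_apply, EuclideanSpace.norm_eq, Fin.sum_univ_two, add_comm]
  · simp [pauliCLM_two_apply, EuclideanSpace.norm_eq, Fin.sum_univ_two]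

theorem enorm_pauliCLM_apply (j : Fin 3) (v : Spinor) : ‖pauliCLM j v‖ₑ = ‖v‖ₑ := by
  rw [← ofReal_norm, norm_pauliCLM_apply, ofReal_norm]

/-- The Clifford relations, tested against a symmetric tensor `a δⱼₖ + b zₖ zⱼ`. -/
theorem sum_pauliCLM_pauliCLM (a b : ℝ) (z : Space3) (v : Spinor) :
    ∑ k, ∑ j, ((if j = k then a else 0) + b * (z k * z j)) • pauliCLM k (pauliCLM j v) =
      (3 * a + b * ‖z‖ ^ 2) • v := by
  rw [EuclideanSpace.real_norm_sq_eq]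
  simp only [Fin.sum_univ_three, pauliCLM_zero_apply, pauliCLM_one_apply, pauliCLM_two_apply]
  ext i
  have hI : Complex.I ^ 2 = -1 := Complex.I_sq
  fin_cases i <;> simp <;> ring_nf <;> rw [hI] <;> ring

/-! ### Regularized fundamental solution and Green's formula -/

/-- A smooth function `Q` for which the vector field `z Q(|z|²)` agrees with `z |z|⁻³` outside the
unit ball. -/
structure IsKernelProfile (Q : ℝ → ℝ) : Prop where
  contDiff : ContDiff ℝ (⊤ : ℕ∞) Q
  abs_mul_le : ∀ r, 0 ≤ r → |Q (r ^ 2)| * r ≤ r ^ (-2 : ℝ)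
  div_nonneg : ∀ t, 0 ≤ t → 0 ≤ 3 * Q t + 2 * t * deriv Q t
  div_eq_zero : ∀ t, 1 < t → 3 * Q t + 2 * t * deriv Q t = 0
  exists_div_ne_zero : ∃ t, 0 ≤ t ∧ 3 * Q t + 2 * t * deriv Q t ≠ 0

/-- Take `t^(-3/2)` times a smooth step from `0` to `1` on `[1/2, 1]`. The field `z|z|^(-3)` is
divergence free off the origin, so the divergence `3Q + 2tQ'` only sees the derivative of the step:
it is nonnegative and vanishes for `t > 1`. -/
theorem exists_isKernelProfile : ∃ Q, IsKernelProfile Q := by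
  set s : ℝ → ℝ := fun t => Real.smoothTransition (2 * t - 1) with hs
  have hsc : ContDiff ℝ (⊤ : ℕ∞) s := Real.smoothTransition.contDiff.comp (by fun_prop)
  have hsmono : Monotone s := fun x y h => Real.smoothTransition.monotone (by linarith)
  have hs0 : ∀ t, t ≤ 1 / 2 → s t = 0 := fun t h =>
    Real.smoothTransition.zero_of_nonpos (by linarith)
  have hs1 : ∀ t, 1 ≤ t → s t = 1 := fun t h =>
    Real.smoothTransition.one_of_one_le (by linarith)
  set Q : ℝ → ℝ := fun t => s t * t ^ (-3 / 2 : ℝ) with hQ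
  have hQ0 : ∀ t, t < 1 / 2 → Q =ᶠ[𝓝 t] fun _ => 0 := fun t h => by
    filter_upwards [eventually_lt_nhds h] with u hu
    simp [hQ, hs0 u hu.le]
  have hdiv : ∀ t, 0 < t → 3 * Q t + 2 * t * deriv Q t = 2 * t ^ (-1 / 2 : ℝ) * deriv s t := by
    intro t ht
    have h1 : HasDerivAt s (deriv s t) t := (hsc.differentiable (by simp) t).hasDerivAt
    have h2 := Real.hasDerivAt_rpow_const (x := t) (p := -3 / 2) (Or.inl ht.ne')
    have h3 : deriv Q t = _ := (h1.mul h2).deriv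
    have e1 : t ^ (-1 / 2 : ℝ) = t * t ^ (-3 / 2 : ℝ) := by
      rw [show (-1 / 2 : ℝ) = 1 + -3 / 2 by norm_num, Real.rpow_add ht, Real.rpow_one]
    have e2 : t ^ (-3 / 2 : ℝ) = t * t ^ (-3 / 2 - 1 : ℝ) := by
      rw [← Real.rpow_one_add' ht.le (by norm_num)]; norm_num
    rw [h3, e1]
    simp only [hQ]
    rw [e2]; ring
  refine ⟨Q, ?_, ?_, ?_, ?_, ?_⟩
  · rw [contDiff_iff_contDiffAt]
    intro t
    rcases lt_or_ge t (1 / 2) with h | h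
    · exact contDiffAt_const.congr_of_eventuallyEq (hQ0 t h)
    · exact hsc.contDiffAt.mul (Real.contDiffAt_rpow_const_of_ne (by linarith))
  · intro r hr
    rcases hr.eq_or_lt with rfl | hr
    · simp
    have h0 : 0 ≤ s (r ^ 2) := Real.smoothTransition.nonneg _
    have h1 : s (r ^ 2) ≤ 1 := Real.smoothTransition.le_one _
    have e : (r ^ 2) ^ (-3 / 2 : ℝ) * r = r ^ (-2 : ℝ) := by
      rw [← Real.rpow_natCast, ← Real.rpow_mul hr.le]
      nth_rewrite 2 [← Real.rpow_one r]
      rw [← Real.rpow_add hr]; norm_num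
    simp only [hQ]
    rw [abs_of_nonneg (by positivity), mul_assoc, e]
    exact mul_le_of_le_one_left (by positivity) h1
  · intro t ht
    rcases ht.eq_or_lt with rfl | ht
    · simp [hQ, hs0]
    · rw [hdiv t ht]
      have := hsmono.deriv_nonneg (x := t)
      positivity
  · intro t ht
    have : s =ᶠ[𝓝 t] fun _ => 1 := by
      filter_upwards [eventually_gt_nhds ht] with u hu using hs1 u hu.le
    rw [hdiv t (by linarith), this.deriv_eq]; simp
  -- The step rises from `0` to `1` between `1/4` and `1`, so its derivative is nonzero somewhere in
  -- between.
  · obtain ⟨c, hc, h⟩ := exists_deriv_eq_slope s (a := 1 / 4) (b := 1) (by norm_num)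
      hsc.continuous.continuousOn (hsc.differentiable (by simp)).differentiableOn
    have hc0 : 0 < c := by linarith [hc.1]
    refine ⟨c, hc0.le, ?_⟩
    rw [hdiv c hc0, h, hs0 (1 / 4) (by norm_num), hs1 1 le_rfl]
    have : 0 < c ^ (-1 / 2 : ℝ) := by positivity
    exact (by positivity : 0 < 2 * c ^ (-1 / 2 : ℝ) * ((1 - 0) / (1 - 1 / 4))).ne'

theorem hasFDerivAt_coord_mul_radial {q : ℝ → ℝ} (hq : Differentiable ℝ q) (k : Fin 3)
    (x y : Space3) :
    HasFDerivAt (fun y : Space3 => (x - y) k * q (‖x - y‖ ^ 2))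
      (-((x - y) k • (2 * deriv q (‖x - y‖ ^ 2)) • innerSL ℝ (x - y) +
        q (‖x - y‖ ^ 2) • EuclideanSpace.proj (𝕜 := ℝ) k)) y := by
  have h1 : HasFDerivAt (fun y : Space3 => x - y) (-ContinuousLinearMap.id ℝ Space3) y :=
    (hasFDerivAt_id y).const_sub x
  have h2 : HasFDerivAt (fun y : Space3 => (x - y) k)
      (EuclideanSpace.proj (𝕜 := ℝ) k ∘L (-ContinuousLinearMap.id ℝ Space3)) y :=
    (EuclideanSpace.proj k : Space3 →L[ℝ] ℝ).hasFDerivAt.comp y h1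
  have h3 := h1.norm_sq
  have h4 := (hq (‖x - y‖ ^ 2)).hasDerivAt.comp_hasFDerivAt y h3
  refine (h2.mul h4).congr_fderiv ?_
  ext v
  simp
  ring

theorem contDiff_coord_mul_radial {q : ℝ → ℝ} (hq : ContDiff ℝ (⊤ : ℕ∞) q) (k : Fin 3)
    (x : Space3) : ContDiff ℝ (⊤ : ℕ∞) (fun y : Space3 => (x - y) k * q (‖x - y‖ ^ 2)) := by
  have h1 : ContDiff ℝ (⊤ : ℕ∞) (fun y : Space3 => x - y) := by fun_prop
  exact ((EuclideanSpace.proj k : Space3 →L[ℝ] ℝ).contDiff.comp h1).mul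
    (hq.comp (h1.norm_sq ℝ))

/-- Green's formula for the Dirac operator against the test functions
`θ(y) (x - y)ₖ q(|x - y|²)`. -/
theorem integral_div_smul_eq {q : ℝ → ℝ} (hq : ContDiff ℝ (⊤ : ℕ∞) q) {θ : Space3 → ℝ}
    (hθ : ContDiff ℝ (⊤ : ℕ∞) θ) (hθc : HasCompactSupport θ) {g : Space3 → Spinor}
    {h : Fin 3 → Space3 → Spinor} (hg : IsWeakGradient g h) (x : Space3) :
    ∫ y, (θ y * (3 * q (‖x - y‖ ^ 2) + 2 * ‖x - y‖ ^ 2 * deriv q (‖x - y‖ ^ 2))) • g y =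
      (∑ k, ∫ y, (θ y * ((x - y) k * q (‖x - y‖ ^ 2))) • pauliCLM k (∑ j, pauliCLM j (h j y))) +
      ∑ k, ∑ j, ∫ y, (fderiv ℝ θ y (EuclideanSpace.single j 1) *
        ((x - y) k * q (‖x - y‖ ^ 2))) • pauliCLM k (pauliCLM j (g y)) := by
  set K : Fin 3 → Space3 → ℝ := fun k y => (x - y) k * q (‖x - y‖ ^ 2) with hK
  have hKs : ∀ k, ContDiff ℝ (⊤ : ℕ∞) (K k) := fun k => contDiff_coord_mul_radial hq k x
  have hφ : ∀ k, ContDiff ℝ (⊤ : ℕ∞) (fun y => θ y * K k y) := fun k => hθ.mul (hKs k)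
  have hφc : ∀ k, HasCompactSupport (fun y => θ y * K k y) := fun k => hθc.mul_right
  have hgl : LocallyIntegrable g volume := (hg 0).locallyIntegrable
  have hθd : ∀ j : Fin 3, Continuous fun y => fderiv ℝ θ y (EuclideanSpace.single j 1) :=
    fun j => (hθ.continuous_fderiv (by simp)).clm_apply continuous_const
  have hθdc : ∀ j : Fin 3, HasCompactSupport fun y => fderiv ℝ θ y (EuclideanSpace.single j 1) :=
    fun j => hθc.fderiv_apply ℝ _
  have ig : ∀ (u : Space3 → ℝ), Continuous u → HasCompactSupport u → ∀ k j,
      Integrable (fun y => u y • pauliCLM k (pauliCLM j (g y))) volume := by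
    intro u hu huc k j
    have := ((pauliCLM k).comp (pauliCLM j)).integrable_comp
      (hgl.integrable_smul_left_of_hasCompactSupport hu huc)
    simpa using this
  have ih : ∀ (u : Space3 → ℝ), Continuous u → HasCompactSupport u → ∀ k j,
      Integrable (fun y => u y • pauliCLM k (pauliCLM j (h j y))) volume := by
    intro u hu huc k j
    have := ((pauliCLM k).comp (pauliCLM j)).integrable_comp
      ((hg j).locallyIntegrable_deriv.integrable_smul_left_of_hasCompactSupport hu huc)
    simpa using this
  have weak : ∀ k j, ∫ y, fderiv ℝ (fun y => θ y * K k y) y (EuclideanSpace.single j 1) •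
      pauliCLM k (pauliCLM j (g y)) =
      - ∫ y, (θ y * K k y) • pauliCLM k (pauliCLM j (h j y)) := by
    intro k j
    have e := congrArg ((pauliCLM k).comp (pauliCLM j)) ((hg j).integral_eq _ (hφ k) (hφc k))
    rw [map_neg, ← ContinuousLinearMap.integral_comp_comm, ← ContinuousLinearMap.integral_comp_comm]
      at e
    · simpa using e
    · exact (hg j).locallyIntegrable_deriv.integrable_smul_left_of_hasCompactSupport
        (hφ k).continuous (hφc k)
    · exact hgl.integrable_smul_left_of_hasCompactSupport
        (((hφ k).continuous_fderiv (by simp)).clm_apply continuous_const)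
        ((hφc k).fderiv_apply ℝ _)
  have dφ : ∀ k j y, fderiv ℝ (fun y => θ y * K k y) y (EuclideanSpace.single j 1) =
      fderiv ℝ θ y (EuclideanSpace.single j 1) * K k y -
      θ y * ((if j = k then q (‖x - y‖ ^ 2) else 0) +
        2 * deriv q (‖x - y‖ ^ 2) * ((x - y) k * (x - y) j)) := by
    intro k j y
    have h1 := (hθ.differentiable (by simp) y).hasFDerivAt.mul
      (hasFDerivAt_coord_mul_radial (hq.differentiable (by simp)) k x y)
    rw [show fderiv ℝ (fun y => θ y * K k y) y = _ from h1.fderiv]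
    rcases eq_or_ne j k with rfl | hjk
    · simp [EuclideanSpace.inner_single_right, hK]
      ring
    · simp [EuclideanSpace.inner_single_right, hK, hjk, hjk.symm]
      ring
  -- The Jacobian of `z q(|z|²)` is symmetric, so contracting it with `σₖσⱼ` leaves only its trace,
  -- the divergence.
  have pt : ∀ y, (θ y * (3 * q (‖x - y‖ ^ 2) + 2 * ‖x - y‖ ^ 2 * deriv q (‖x - y‖ ^ 2))) • g y =
      ∑ k, ∑ j, ((fderiv ℝ θ y (EuclideanSpace.single j 1) * K k y) •
          pauliCLM k (pauliCLM j (g y)) -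
        fderiv ℝ (fun y => θ y * K k y) y (EuclideanSpace.single j 1) •
          pauliCLM k (pauliCLM j (g y))) := by
    intro y
    have e := sum_pauliCLM_pauliCLM (q (‖x - y‖ ^ 2)) (2 * deriv q (‖x - y‖ ^ 2)) (x - y) (g y)
    simp_rw [← sub_smul, dφ, sub_sub_cancel, mul_smul, ← Finset.smul_sum, e]
    congr 2; ring
  have i1 : ∀ k j, Integrable (fun y => (fderiv ℝ θ y (EuclideanSpace.single j 1) * K k y) •
          pauliCLM k (pauliCLM j (g y))) volume := fun k j =>
    ig _ ((hθd j).mul (hKs k).continuous) (hθdc j).mul_right k j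
  have i2 : ∀ k j, Integrable (fun y =>
      fderiv ℝ (fun y => θ y * K k y) y (EuclideanSpace.single j 1) •
          pauliCLM k (pauliCLM j (g y))) volume := fun k j =>
    ig _ (((hφ k).continuous_fderiv (by simp)).clm_apply continuous_const)
        ((hφc k).fderiv_apply ℝ _) k j
  have i3 : ∀ k j, Integrable (fun y => (fderiv ℝ θ y (EuclideanSpace.single j 1) * K k y) •
          pauliCLM k (pauliCLM j (g y)) -
        fderiv ℝ (fun y => θ y * K k y) y (EuclideanSpace.single j 1) •
          pauliCLM k (pauliCLM j (g y))) volume := fun k j => (i1 k j).sub (i2 k j)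
  simp_rw [pt, map_sum, Finset.smul_sum]
  rw [integral_finsetSum _ fun k _ => integrable_finsetSum _ fun j _ => i3 k j,
    ← Finset.sum_add_distrib]
  refine Finset.sum_congr rfl fun k _ => ?_
  rw [integral_finsetSum _ fun j _ => i3 k j,
    integral_finsetSum _ fun j _ => ih _ (hφ k).continuous (hφc k) k j, ← Finset.sum_add_distrib]
  refine Finset.sum_congr rfl fun j _ => ?_
  rw [integral_sub (i1 k j) (i2 k j), weak]
  abel

/-- Pauli matrices are isometries and the field is bounded by `|x - y|^(-2)`, so each of the `3 + 9`
integrals in Green's formula is at most the integral on the right. -/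
theorem enorm_integral_div_smul_le {q : ℝ → ℝ} (hq : ContDiff ℝ (⊤ : ℕ∞) q)
    (hqle : ∀ r, 0 ≤ r → |q (r ^ 2)| * r ≤ r ^ (-2 : ℝ)) {θ : Space3 → ℝ}
    (hθ : ContDiff ℝ (⊤ : ℕ∞) θ) (hθc : HasCompactSupport θ) {g : Space3 → Spinor}
    {h : Fin 3 → Space3 → Spinor} (hg : IsWeakGradient g h) (x : Space3) :
    ‖∫ y, (θ y * (3 * q (‖x - y‖ ^ 2) + 2 * ‖x - y‖ ^ 2 * deriv q (‖x - y‖ ^ 2))) • g y‖ₑ ≤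
      12 * ∫⁻ y, normPow (-2) (x - y) *
        (‖θ y‖ₑ * ‖∑ j, pauliCLM j (h j y)‖ₑ + ‖fderiv ℝ θ y‖ₑ * ‖g y‖ₑ) := by
  set I := ∫⁻ y, normPow (-2) (x - y) *
        (‖θ y‖ₑ * ‖∑ j, pauliCLM j (h j y)‖ₑ + ‖fderiv ℝ θ y‖ₑ * ‖g y‖ₑ)
  have hK : ∀ k y, ‖(x - y) k * q (‖x - y‖ ^ 2)‖ₑ ≤ normPow (-2) (x - y) := by
    intro k y
    unfold normPow
    rw [← ofReal_norm, norm_mul, mul_comm]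
    refine ENNReal.ofReal_le_ofReal (le_trans ?_ (hqle _ (norm_nonneg _)))
    rw [Real.norm_eq_abs (q _)]
    gcongr
    exact PiLp.norm_apply_le _ _
  have h1 : ∀ k, ‖∫ y, (θ y * ((x - y) k * q (‖x - y‖ ^ 2))) •
      pauliCLM k (∑ j, pauliCLM j (h j y))‖ₑ ≤ I := by
    intro k
    refine (enorm_integral_le_lintegral_enorm _).trans (lintegral_mono fun y => ?_)
    rw [enorm_smul, enorm_mul, enorm_pauliCLM_apply, mul_comm ‖θ y‖ₑ, mul_assoc]
    gcongr
    · exact hK k y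
    · exact le_self_add
  have h2 : ∀ k j, ‖∫ y, (fderiv ℝ θ y (EuclideanSpace.single j 1) *
        ((x - y) k * q (‖x - y‖ ^ 2))) • pauliCLM k (pauliCLM j (g y))‖ₑ ≤ I := by
    intro k j
    refine (enorm_integral_le_lintegral_enorm _).trans (lintegral_mono fun y => ?_)
    rw [enorm_smul, enorm_mul, enorm_pauliCLM_apply, enorm_pauliCLM_apply,
      mul_comm ‖fderiv ℝ θ y (EuclideanSpace.single j 1)‖ₑ, mul_assoc]
    gcongr
    · exact hK k y
    · refine le_trans ?_ le_add_self
      gcongr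
      refine ((fderiv ℝ θ y).le_opENorm _).trans_eq ?_
      rw [← ofReal_norm (EuclideanSpace.single j (1 : ℝ))]
      simp
  rw [integral_div_smul_eq hq hθ hθc hg x]
  calc _ ≤ (∑ k : Fin 3, I) + ∑ k : Fin 3, ∑ j : Fin 3, I := by
        refine (enorm_add_le _ _).trans (add_le_add ?_ ?_)
        · exact (enorm_sum_le _ _).trans (Finset.sum_le_sum fun k _ => h1 k)
        · exact (enorm_sum_le _ _).trans (Finset.sum_le_sum fun k _ =>
            (enorm_sum_le _ _).trans (Finset.sum_le_sum fun j _ => h2 k j))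
    _ = 12 * I := by
        simp only [Finset.sum_const, Finset.card_univ, Fintype.card_fin, nsmul_eq_mul]
        push_cast; ring

/-- A localized pointwise bound of a spinor by the Riesz potential of its Dirac derivative. -/
theorem exists_ae_enorm_smul_le : ∃ c : ℝ, 0 < c ∧ ∀ (g : Space3 → Spinor)
    (h : Fin 3 → Space3 → Spinor), IsWeakGradient g h → ∀ θ : Space3 → ℝ,
    ContDiff ℝ (⊤ : ℕ∞) θ → HasCompactSupport θ → ∀ᵐ x : Space3, ENNReal.ofReal c * ‖θ x • g x‖ₑ ≤
      12 * ∫⁻ y, normPow (-2) (x - y) *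
        (‖θ y‖ₑ * ‖∑ j, pauliCLM j (h j y)‖ₑ + ‖fderiv ℝ θ y‖ₑ * ‖g y‖ₑ) := by
  obtain ⟨Q, hQ⟩ := exists_isKernelProfile
  set η : Space3 → ℝ := fun z => 3 * Q (‖z‖ ^ 2) + 2 * ‖z‖ ^ 2 * deriv Q (‖z‖ ^ 2) with hη
  have hηc : Continuous η := by
    have h1 := hQ.contDiff.continuous
    have h2 : Continuous (deriv Q) := hQ.contDiff.continuous_deriv (by simp)
    fun_prop
  have hη0 : ∀ z, 1 < ‖z‖ → η z = 0 := fun z hz =>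
    hQ.div_eq_zero _ (one_lt_pow₀ hz two_ne_zero)
  have hηs : HasCompactSupport η := HasCompactSupport.intro (isCompact_closedBall (0 : Space3) 1)
    fun z hz => hη0 z (by simpa using hz)
  obtain ⟨t, ht, ht'⟩ := hQ.exists_div_ne_zero
  have hη1 : η (EuclideanSpace.single 0 (√t)) ≠ 0 := by
    simpa [hη, Real.sq_sqrt ht] using ht'
  have hpos : 0 < ∫ z, η z := hηc.integral_pos_of_hasCompactSupport_nonneg_nonzero hηs
    (fun z => hQ.div_nonneg _ (by positivity)) hη1
  obtain ⟨M, hM⟩ := hηc.bounded_above_of_compact_support hηs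
  set c := ∫ z, η z with hc
  refine ⟨c, hpos, fun g h hg θ hθ hθc => ?_⟩
  have hf : LocallyIntegrable (fun y => θ y • g y) volume :=
    ((hg 0).locallyIntegrable.integrable_smul_left_of_hasCompactSupport
      hθ.continuous hθc).locallyIntegrable
  -- At Lebesgue points of `θ g`, averaging against the approximate identity `c⁻¹ l³ η(l ·)`
  -- converges to the value of `θ g`.
  filter_upwards [(Besicovitch.vitaliFamily volume).ae_tendsto_average_norm_sub hf] with x hx
  set l : ℕ → ℝ := fun n => n + 1
  have hl : ∀ n, 0 < l n := fun n => by positivity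
  have hlt : Tendsto (fun n => (l n)⁻¹) atTop (𝓝[>] 0) := by
    refine tendsto_nhdsWithin_iff.2 ⟨?_, Eventually.of_forall fun n => inv_pos.2 (hl n)⟩
    exact tendsto_inv_atTop_zero.comp (tendsto_atTop_add_const_right _ _ tendsto_natCast_atTop_atTop)
  have hx' := hx.comp ((Besicovitch.tendsto_filterAt volume x).comp hlt)
  have lim : Tendsto (fun n => ∫ y, (c⁻¹ * (l n ^ 3 * η (l n • (x - y)))) • (θ y • g y)) atTop
      (𝓝 (θ x • g x)) := by
    refine tendsto_integral_smul_of_tendsto_average_norm_sub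
      (c⁻¹ * M * volume.real (closedBall (0 : Space3) 1)) hx' ?_ ?_ ?_ ?_
    · exact Eventually.of_forall fun n => hf.integrableOn_isCompact (isCompact_closedBall _ _)
    · refine tendsto_const_nhds.congr fun n => ?_
      rw [integral_const_mul, integral_const_mul,
        integral_sub_left_eq_self (fun y => η (l n • y)) volume x,
        Measure.integral_comp_smul, finrank_euclideanSpace_fin, ← hc, smul_eq_mul,
        abs_of_pos (by have := hl n; positivity)]
      have := (hl n).ne'
      field_simp
    · refine Eventually.of_forall fun n y hy => ?_
      simp only [Function.comp, mem_closedBall]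
      by_contra! hlt
      refine hy ?_
      simp only
      rw [hη0, mul_zero, mul_zero]
      rw [norm_smul, Real.norm_of_nonneg (hl n).le, ← dist_eq_norm, dist_comm]
      rwa [inv_lt_iff_one_lt_mul₀' (hl n)] at hlt
    · refine Eventually.of_forall fun n y => ?_
      have e : volume.real (closedBall x (l n)⁻¹) =
          ((l n)⁻¹) ^ 3 * volume.real (closedBall (0 : Space3) 1) := by
        rw [Measure.addHaar_real_closedBall' volume x (inv_pos.2 (hl n)).le,
          finrank_euclideanSpace_fin]
      have hv : 0 < volume.real (closedBall (0 : Space3) 1) :=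
        
        ENNReal.toReal_pos (measure_closedBall_pos volume _ one_pos).ne'
          measure_closedBall_lt_top.ne
      simp only [Function.comp]
      rw [e, inv_pow, mul_div_mul_right _ _ hv.ne', div_inv_eq_mul, abs_mul, abs_mul,
        abs_of_pos (inv_pos.2 hpos), abs_of_pos (pow_pos (hl n) 3), mul_assoc, mul_comm M]
      exact mul_le_mul_of_nonneg_left (mul_le_mul_of_nonneg_left (hM _) (pow_pos (hl n) 3).le)
        (inv_pos.2 hpos).le
  refine le_of_tendsto' ((ENNReal.continuous_const_mul ENNReal.ofReal_ne_top).tendsto _ |>.comp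
    lim.enorm) fun n => ?_
  have hn := hl n
  -- The rescaled profile whose field has divergence `l³ η(l z)`. The bound by `|z|^(-2)` is scale
  -- invariant, so the estimate is uniform in `n`.
  set q : ℝ → ℝ := fun t => l n ^ 3 * Q (l n ^ 2 * t) with hq
  have hqd : ∀ t, deriv q t = l n ^ 3 * (l n ^ 2 * deriv Q (l n ^ 2 * t)) := by
    intro t
    rw [hq, deriv_const_mul_field, deriv_comp_mul_left]
    simp
  have hqle : ∀ r, 0 ≤ r → |q (r ^ 2)| * r ≤ r ^ (-2 : ℝ) := by
    intro r hr
    have h1 := hQ.abs_mul_le (l n * r) (by positivity)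
    have h2 : (l n) ^ (-2 : ℝ) * l n ^ 2 = 1 := by
      rw [← Real.rpow_natCast, ← Real.rpow_add hn]; simp
    rw [Real.mul_rpow hn.le hr, mul_pow] at h1
    simp only [hq]
    rw [abs_mul, abs_of_pos (by positivity)]
    calc _ = l n ^ 2 * (|Q (l n ^ 2 * r ^ 2)| * (l n * r)) := by ring
      _ ≤ l n ^ 2 * (l n ^ (-2 : ℝ) * r ^ (-2 : ℝ)) := by gcongr
      _ = (l n ^ (-2 : ℝ) * l n ^ 2) * r ^ (-2 : ℝ) := by ring
      _ = _ := by rw [h2, one_mul]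
  have hqs : ContDiff ℝ (⊤ : ℕ∞) q :=
    contDiff_const.mul (hQ.contDiff.comp (contDiff_const.mul contDiff_id))
  refine le_trans (le_of_eq ?_) (enorm_integral_div_smul_le hqs hqle hθ hθc hg x)
  have e : ∀ y, (c⁻¹ * (l n ^ 3 * η (l n • (x - y)))) • (θ y • g y) = c⁻¹ •
      ((θ y * (3 * q (‖x - y‖ ^ 2) + 2 * ‖x - y‖ ^ 2 * deriv q (‖x - y‖ ^ 2))) • g y) := by
    intro y
    rw [smul_smul, smul_smul, hqd]
    simp only [hη, hq, norm_smul, Real.norm_of_nonneg hn.le, mul_pow]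
    congr 1; ring
  simp only [Function.comp]
  rw [integral_congr_ae (ae_of_all _ e), integral_smul, enorm_smul, ← mul_assoc, ← ofReal_norm c⁻¹,
    ← ENNReal.ofReal_mul hpos.le, Real.norm_of_nonneg (inv_pos.2 hpos).le,
    mul_inv_cancel₀ hpos.ne', ENNReal.ofReal_one, one_mul]

/-! ### Annular cutoffs and the outer cutoff error -/

theorem ContDiffBump.exists_norm_fderiv_le (b : ContDiffBump (0 : Space3)) :
    ∃ M, 0 ≤ M ∧ ∀ y, ‖fderiv ℝ b y‖ ≤
      {y : Space3 | b.rIn ≤ ‖y‖ ∧ ‖y‖ ≤ b.rOut}.indicator (fun _ => M) y := by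
  have hc : Continuous (fderiv ℝ b) := (b.contDiff (n := 1)).continuous_fderiv one_ne_zero
  obtain ⟨M, hM⟩ := hc.bounded_above_of_compact_support (b.hasCompactSupport.fderiv ℝ)
  refine ⟨M, (norm_nonneg _).trans (hM 0), fun y => ?_⟩
  by_cases hy : b.rIn ≤ ‖y‖ ∧ ‖y‖ ≤ b.rOut
  · rw [Set.indicator_of_mem (by exact hy)]; exact hM y
  · rw [Set.indicator_of_notMem (by exact hy)]
    refine le_of_eq (norm_eq_zero.2 ?_)
    rw [not_and_or, not_le, not_le] at hy
    rcases hy with hy | hy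
    · have : b =ᶠ[𝓝 y] 1 := b.eventuallyEq_one_of_mem_ball (by simpa using hy)
      rw [this.fderiv_eq]
      simp
    · by_contra hne
      have := support_fderiv_subset ℝ (f := b) hne
      rw [b.tsupport_eq] at this
      simp at this
      linarith

/-- A fixed inner cutoff times a dilated outer bump. Dilation makes the outer gradient `O(1/L)`,
with `M` independent of `L`, which the limit `L → ∞` relies on. -/
theorem exists_annular_cutoff {r : ℝ} (hr : 0 < r) : ∃ M : ℝ, 0 ≤ M ∧ ∀ L : ℝ, 0 < L →
    ∃ θ : Space3 → ℝ, ContDiff ℝ (⊤ : ℕ∞) θ ∧ HasCompactSupport θ ∧ (∀ y, ‖θ y‖ ≤ 1) ∧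
      (∀ y, ‖y‖ < r → θ y = 0) ∧ (∀ y, 2 * r ≤ ‖y‖ → ‖y‖ ≤ L → θ y = 1) ∧
      ∀ y, ‖fderiv ℝ θ y‖ ≤ {y : Space3 | r ≤ ‖y‖ ∧ ‖y‖ ≤ 2 * r}.indicator (fun _ => M) y +
        {y : Space3 | L ≤ ‖y‖ ∧ ‖y‖ ≤ 2 * L}.indicator (fun _ => M / L) y := by
  let b₀ : ContDiffBump (0 : Space3) := ⟨r, 2 * r, hr, by linarith⟩
  let b : ContDiffBump (0 : Space3) := ⟨1, 2, by norm_num, by norm_num⟩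
  obtain ⟨M₀, hM₀, h₀⟩ := b₀.exists_norm_fderiv_le
  obtain ⟨M₁, hM₁, h₁⟩ := b.exists_norm_fderiv_le
  refine ⟨max M₀ M₁, le_max_of_le_left hM₀, fun L hL => ?_⟩
  have hbL : ContDiff ℝ (⊤ : ℕ∞) (fun y : Space3 => b (L⁻¹ • y)) :=
    b.contDiff.comp (contDiff_const_smul _)
  have hnorm : ∀ y : Space3, ‖L⁻¹ • y‖ = ‖y‖ / L := fun y => by
    rw [norm_smul, norm_inv, Real.norm_of_nonneg hL.le, inv_mul_eq_div]
  refine ⟨fun y => (1 - b₀ y) * b (L⁻¹ • y), (contDiff_const.sub b₀.contDiff).mul hbL, ?_, ?_, ?_,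
    ?_, ?_⟩
  · have : HasCompactSupport (fun y : Space3 => b (L⁻¹ • y)) :=
      b.hasCompactSupport.comp_smul (inv_ne_zero hL.ne')
    exact this.mul_left
  · intro y
    rw [norm_mul, Real.norm_of_nonneg (sub_nonneg.2 b₀.le_one), Real.norm_of_nonneg b.nonneg]
    exact mul_le_one₀ (sub_le_self _ b₀.nonneg) b.nonneg b.le_one
  · intro y hy
    simp only
    rw [b₀.one_of_mem_closedBall (by simpa [b₀] using hy.le)]; simp
  · intro y hy hyL
    simp only
    rw [b₀.zero_of_le_dist (by simpa [b₀] using hy), b.one_of_mem_closedBall]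
    · simp
    · rw [mem_closedBall_zero_iff, hnorm]
      exact (div_le_one hL).2 hyL
  · intro y
    have d₀ : HasFDerivAt (fun y => 1 - b₀ y) (-fderiv ℝ b₀ y) y :=
      ((b₀.contDiff (n := 1)).differentiable (by simp) y).hasFDerivAt.const_sub 1
    have d₁ : HasFDerivAt (fun y : Space3 => b (L⁻¹ • y))
        (fderiv ℝ b (L⁻¹ • y) ∘L (L⁻¹ • ContinuousLinearMap.id ℝ Space3)) y :=
      ((b.contDiff (n := 1)).differentiable (by simp) _).hasFDerivAt.comp y
        ((hasFDerivAt_id y).const_smul L⁻¹)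
    rw [show fderiv ℝ (fun y => (1 - b₀ y) * b (L⁻¹ • y)) y = _ from (d₀.mul d₁).fderiv,
      add_comm (_ • _ : Space3 →L[ℝ] ℝ)]
    refine (norm_add_le _ _).trans (add_le_add ?_ ?_)
    · rw [norm_smul, norm_neg, Real.norm_of_nonneg b.nonneg]
      refine (mul_le_of_le_one_left (norm_nonneg _) b.le_one).trans ((h₀ y).trans ?_)
      exact Set.indicator_le_indicator (le_max_left _ _)
    · rw [norm_smul, Real.norm_of_nonneg (sub_nonneg.2 b₀.le_one)]
      refine (mul_le_of_le_one_left (norm_nonneg _) (sub_le_self _ b₀.nonneg)).trans ?_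
      have h2 : ‖fderiv ℝ b (L⁻¹ • y) ∘L (L⁻¹ • ContinuousLinearMap.id ℝ Space3)‖ ≤
          ‖fderiv ℝ b (L⁻¹ • y)‖ * L⁻¹ := by
        refine (ContinuousLinearMap.opNorm_comp_le _ _).trans ?_
        gcongr
        rw [norm_smul, norm_inv, Real.norm_of_nonneg hL.le]
        exact mul_le_of_le_one_right (inv_pos.2 hL).le ContinuousLinearMap.norm_id_le
      refine h2.trans ?_
      have h3 := h₁ (L⁻¹ • y)
      by_cases hy : L ≤ ‖y‖ ∧ ‖y‖ ≤ 2 * L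
      · rw [Set.indicator_of_mem (by exact hy), div_eq_mul_inv]
        gcongr
        refine h3.trans (Set.indicator_le_self' (fun _ _ => hM₁) _ |>.trans (le_max_right _ _))
      · rw [Set.indicator_of_notMem (by exact hy)]
        rw [Set.indicator_of_notMem] at h3
        · rw [le_antisymm h3 (norm_nonneg _), zero_mul]
        · simp only [Set.mem_ofPred_eq, hnorm]
          rwa [le_div_iff₀ hL, div_le_iff₀ hL, show b.rIn = 1 from rfl,
            show b.rOut = 2 from rfl, one_mul]

/-- By Hölder the integral is `O(L^(3 - 3/p))`, so the whole is `O(L^(-3/p))`. The factor `L^(-3)`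
is the size of the kernel, `L^(-2)`, times that of the outer gradient, `L^(-1)`. -/
theorem tendsto_lintegral_annulus {g : Space3 → Spinor} {p : ℝ≥0∞} (hp : 1 ≤ p) (hp_top : p ≠ ∞)
    (hg : MemLp g p volume) :
    Tendsto (fun L : ℝ => ENNReal.ofReal (L ^ (-3 : ℝ)) * ∫⁻ y in closedBall 0 (2 * L), ‖g y‖ₑ)
      atTop (𝓝 0) := by
  have hp0 : 0 < p.toReal := ENNReal.toReal_pos (by positivity) hp_top
  have hp1 : 1 ≤ p.toReal := by
    simpa using ENNReal.toReal_mono hp_top hp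
  set e : ℝ := 1 - 1 / p.toReal with he
  have he0 : 0 ≤ e := by
    rw [he, sub_nonneg, div_le_one hp0]; exact hp1
  set v := volume (closedBall (0 : Space3) 1)
  set N := eLpNorm g p volume * (ENNReal.ofReal 8 * v) ^ e
  have hv : v ≠ ∞ := measure_closedBall_lt_top.ne
  have hN : N ≠ ∞ := ENNReal.mul_ne_top hg.eLpNorm_ne_top
    (ENNReal.rpow_ne_top_of_nonneg he0 (ENNReal.mul_ne_top ENNReal.ofReal_ne_top hv))
  have hlim : Tendsto (fun L : ℝ => N * ENNReal.ofReal (L ^ (-(3 / p.toReal)))) atTop (𝓝 0) := by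
    have := ENNReal.Tendsto.const_mul (ENNReal.tendsto_ofReal
      (tendsto_rpow_neg_atTop (y := 3 / p.toReal) (by positivity))) (Or.inr hN)
    simpa using this
  refine tendsto_of_tendsto_of_tendsto_of_le_of_le' tendsto_const_nhds hlim
    (Eventually.of_forall fun _ => zero_le) ?_
  filter_upwards [eventually_gt_atTop 0] with L hL
  have h1 : ∫⁻ y in closedBall (0 : Space3) (2 * L), ‖g y‖ₑ ≤
      eLpNorm g p volume * (volume (closedBall (0 : Space3) (2 * L))) ^ e := by
    have := eLpNorm_le_eLpNorm_mul_rpow_measure_univ (μ := volume.restrict (closedBall 0 (2 * L)))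
      hp hg.1.restrict
    rw [eLpNorm_one_eq_lintegral_enorm, Measure.restrict_apply_univ, ENNReal.toReal_one,
      div_one] at this
    exact this.trans (mul_le_mul_left (eLpNorm_mono_measure g Measure.restrict_le_self) _)
  have h2 : volume (closedBall (0 : Space3) (2 * L)) =
      ENNReal.ofReal (L ^ 3) * (ENNReal.ofReal 8 * v) := by
    rw [Measure.addHaar_closedBall' volume _ (by positivity), finrank_euclideanSpace_fin,
      ← mul_assoc, ← ENNReal.ofReal_mul (by positivity)]
    congr 2; ring
  rw [h2, ENNReal.mul_rpow_of_nonneg _ _ he0] at h1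
  calc _ ≤ ENNReal.ofReal (L ^ (-3 : ℝ)) * (eLpNorm g p volume *
        (ENNReal.ofReal (L ^ 3) ^ e * (ENNReal.ofReal 8 * v) ^ e)) := by gcongr
    _ = N * (ENNReal.ofReal (L ^ (-3 : ℝ)) * ENNReal.ofReal (L ^ 3) ^ e) := by
        simp only [N]; ring
    _ = _ := by
        rw [ENNReal.ofReal_rpow_of_nonneg (by positivity) he0, ← ENNReal.ofReal_mul (by positivity),
          ← Real.rpow_natCast, ← Real.rpow_mul hL.le, ← Real.rpow_add hL]
        congr 3
        rw [he]; push_cast; ring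

/-! ### The integral inequality for solutions -/

theorem enorm_sum_pauliCLM_le {A : Space3 → Space3} {g : Space3 → Spinor}
    {h : Fin 3 → Space3 → Spinor} {y : Space3} {C α : ℝ}
    (hy : sigmaDot (fun j => (-Complex.I) • h j y - (A y j : ℂ) • g y) = 0)
    (hA : ‖A y‖ ≤ C * ‖y‖ ^ (-1 - α)) :
    ‖∑ j, pauliCLM j (h j y)‖ₑ ≤ ENNReal.ofReal (3 * C) * (normPow (-1 - α) y * ‖g y‖ₑ) := by
  have e : (-Complex.I) • ∑ j, pauliCLM j (h j y) = ∑ j, (A y j : ℂ) • pauliCLM j (g y) := by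
    rw [sigmaDot_eq_sum_pauliCLM] at hy
    simp only [map_sub, map_smul, Finset.sum_sub_distrib, ← Finset.smul_sum] at hy
    exact sub_eq_zero.1 hy
  have h1 : ‖∑ j, pauliCLM j (h j y)‖ ≤ 3 * C * (‖y‖ ^ (-1 - α) * ‖g y‖) := by
    calc ‖∑ j, pauliCLM j (h j y)‖ = ‖(-Complex.I) • ∑ j, pauliCLM j (h j y)‖ := by
          rw [norm_smul]; simp
      _ ≤ ∑ j : Fin 3, ‖A y‖ * ‖g y‖ := by
          rw [e]
          refine (norm_sum_le _ _).trans (Finset.sum_le_sum fun j _ => ?_)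
          rw [norm_smul, norm_pauliCLM_apply, Complex.norm_real]
          gcongr
          exact PiLp.norm_apply_le _ _
      _ = 3 * (‖A y‖ * ‖g y‖) := by simp
      _ ≤ 3 * ((C * ‖y‖ ^ (-1 - α)) * ‖g y‖) := by gcongr
      _ = _ := by ring
  calc ‖∑ j, pauliCLM j (h j y)‖ₑ = ENNReal.ofReal ‖∑ j, pauliCLM j (h j y)‖ :=
        (ofReal_norm _).symm
    _ ≤ _ := ENNReal.ofReal_le_ofReal h1
    _ = _ := by
        rw [ENNReal.ofReal_mul' (by positivity),
          ENNReal.ofReal_mul (p := ‖y‖ ^ (-1 - α)) (by positivity), ofReal_norm]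
        rfl

theorem measurableSet_le_norm (r : ℝ) : MeasurableSet {y : Space3 | r ≤ ‖y‖} :=
  measurableSet_le measurable_const measurable_norm

/-- Outside a large ball, a solution is dominated by the Riesz potential of its own decaying
potential term. -/
theorem exists_ae_enorm_le_riesz {A : Space3 → Space3} {α r C : ℝ} (hα : 0 < α) (hr : 0 < r)
    (hA : ∀ᵐ x : Space3, r ≤ ‖x‖ → ‖A x‖ ≤ C * ‖x‖ ^ (-1 - α))
    {p : ℝ≥0∞} (hp : 1 ≤ p) (hp_top : p ≠ ∞) {g : Space3 → Spinor} (hg : MemLp g p volume)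
    (hsol : SolvesPauliEquation A g) :
    ∃ D : ℝ≥0∞, D ≠ ∞ ∧ ∀ᵐ x : Space3, 2 * r ≤ ‖x‖ → ‖g x‖ₑ ≤
      D * ∫⁻ y in {y | r ≤ ‖y‖}, normPow (-2) (x - y) * (normPow (-1 - α) y * ‖g y‖ₑ) := by
  obtain ⟨h, hgh, heq⟩ := hsol
  obtain ⟨c, hc, hrep⟩ := exists_ae_enorm_smul_le
  obtain ⟨M, hM, hcut⟩ := exists_annular_cutoff hr
  choose! θ hθs hθc hθ1 hθ0 hθe hθd using hcut
  set S : Set Space3 := {y | r ≤ ‖y‖}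
  have hS : MeasurableSet S := measurableSet_le_norm r
  -- The first term comes from the potential. The second absorbs the inner cutoff gradient,
  -- supported where `‖y‖ ≤ 2r`, so that `1 ≤ (2r)^(1+α) ‖y‖^(-1-α)`.
  set D₁ : ℝ≥0∞ := ENNReal.ofReal (3 * C) + ENNReal.ofReal (M * (2 * r) ^ (1 + α))
  have hgm : AEMeasurable (fun y => ‖g y‖ₑ) volume := hg.1.enorm
  have bound : ∀ L : ℝ, 0 < L → ∀ᵐ y : Space3,
      ‖θ L y‖ₑ * ‖∑ j, pauliCLM j (h j y)‖ₑ + ‖fderiv ℝ (θ L) y‖ₑ * ‖g y‖ₑ ≤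
        D₁ * S.indicator (fun y => normPow (-1 - α) y * ‖g y‖ₑ) y +
        ENNReal.ofReal (M / L) *
          {y : Space3 | L ≤ ‖y‖ ∧ ‖y‖ ≤ 2 * L}.indicator (fun y => ‖g y‖ₑ) y := by
    intro L hL
    filter_upwards [heq, hA] with y hy hAy
    have b1 : ‖θ L y‖ₑ * ‖∑ j, pauliCLM j (h j y)‖ₑ ≤
        ENNReal.ofReal (3 * C) * S.indicator (fun y => normPow (-1 - α) y * ‖g y‖ₑ) y := by
      by_cases hyS : y ∈ S
      · rw [Set.indicator_of_mem hyS]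
        refine le_trans ?_ (enorm_sum_pauliCLM_le hy (hAy hyS))
        refine mul_le_of_le_one_left zero_le ?_
        rw [← ofReal_norm]
        simpa using hθ1 L hL y
      · rw [hθ0 L hL y (by simpa [S] using hyS)]; simp
    have b2 : ‖fderiv ℝ (θ L) y‖ₑ * ‖g y‖ₑ ≤
        ENNReal.ofReal (M * (2 * r) ^ (1 + α)) *
          S.indicator (fun y => normPow (-1 - α) y * ‖g y‖ₑ) y +
        ENNReal.ofReal (M / L) *
          {y : Space3 | L ≤ ‖y‖ ∧ ‖y‖ ≤ 2 * L}.indicator (fun y => ‖g y‖ₑ) y := by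
      have d := ENNReal.ofReal_le_ofReal (hθd L hL y)
      rw [ofReal_norm] at d
      refine (mul_le_mul_left (d.trans ENNReal.ofReal_add_le) _).trans ?_
      rw [add_mul]
      refine add_le_add ?_ ?_
      · by_cases hyr : r ≤ ‖y‖ ∧ ‖y‖ ≤ 2 * r
        · rw [Set.indicator_of_mem (by exact hyr), Set.indicator_of_mem (by exact hyr.1),
            ← mul_assoc, normPow, ← ENNReal.ofReal_mul (by positivity)]
          gcongr
          rw [mul_assoc]
          refine le_mul_of_one_le_right hM ?_
          have hy0 : 0 < ‖y‖ := hr.trans_le hyr.1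
          calc (1 : ℝ) = ‖y‖ ^ (1 + α) * ‖y‖ ^ (-1 - α) := by
                rw [← Real.rpow_add hy0]; simp
            _ ≤ _ := by
                gcongr
                exact hyr.2
        · rw [Set.indicator_of_notMem (by exact hyr)]; simp
      · by_cases hyL : L ≤ ‖y‖ ∧ ‖y‖ ≤ 2 * L
        · rw [Set.indicator_of_mem (by exact hyL), Set.indicator_of_mem (by exact hyL)]
        · rw [Set.indicator_of_notMem (by exact hyL)]; simp
    calc _ ≤ _ := add_le_add b1 b2
      _ = _ := by rw [← add_assoc, ← add_mul]
  set T : Space3 → ℝ≥0∞ := fun x => ∫⁻ y in S, normPow (-2) (x - y) *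
    (normPow (-1 - α) y * ‖g y‖ₑ) with hT
  have main : ∀ L : ℝ, 0 < L → ∀ᵐ x : Space3, 2 * r ≤ ‖x‖ → ‖x‖ ≤ L / 2 →
      ENNReal.ofReal c * ‖g x‖ₑ ≤ 12 * (D₁ * T x + ENNReal.ofReal (4 * M) *
        (ENNReal.ofReal (L ^ (-3 : ℝ)) * ∫⁻ y in closedBall 0 (2 * L), ‖g y‖ₑ)) := by
    intro L hL
    filter_upwards [hrep g h hgh (θ L) (hθs L hL) (hθc L hL)] with x hx hx1 hx2
    rw [hθe L hL x hx1 (by linarith), one_smul] at hx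
    refine hx.trans ?_
    gcongr
    set R : Set Space3 := {y : Space3 | L ≤ ‖y‖ ∧ ‖y‖ ≤ 2 * L}
    have hk : Measurable (fun y : Space3 => normPow (-2) (x - y)) := by fun_prop
    have hm1 : AEMeasurable (fun y => normPow (-2) (x - y) *
        (D₁ * S.indicator (fun y => normPow (-1 - α) y * ‖g y‖ₑ) y)) volume := by
      have : AEMeasurable (S.indicator fun y => normPow (-1 - α) y * ‖g y‖ₑ) volume :=
        ((measurable_normPow _).aemeasurable.mul hgm).indicator hS
      fun_prop
    calc _ ≤ ∫⁻ y, (normPow (-2) (x - y) *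
            (D₁ * S.indicator (fun y => normPow (-1 - α) y * ‖g y‖ₑ) y) +
          normPow (-2) (x - y) * (ENNReal.ofReal (M / L) * R.indicator (fun y => ‖g y‖ₑ) y)) := by
          refine lintegral_mono_ae ?_
          filter_upwards [bound L hL] with y hy
          rw [← mul_add]
          gcongr
      _ = (∫⁻ y, normPow (-2) (x - y) *
            (D₁ * S.indicator (fun y => normPow (-1 - α) y * ‖g y‖ₑ) y)) +
          ∫⁻ y, normPow (-2) (x - y) * (ENNReal.ofReal (M / L) *
            R.indicator (fun y => ‖g y‖ₑ) y) := lintegral_add_left' hm1 _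
      _ ≤ _ := by
          refine add_le_add (le_of_eq ?_) ?_
          · simp only [hT]
            rw [← lintegral_indicator hS, ← lintegral_const_mul'']
            · refine lintegral_congr fun y => ?_
              by_cases hy : y ∈ S
              · simp only [Set.indicator_of_mem hy]; ring
              · simp only [Set.indicator_of_notMem hy, mul_zero]
            · exact (hk.aemeasurable.mul ((measurable_normPow _).aemeasurable.mul hgm)).indicator hS
          · rw [← mul_assoc, ← lintegral_indicator measurableSet_closedBall, ← lintegral_const_mul'']
            · refine lintegral_mono fun y => ?_
              by_cases hy : y ∈ R
              · rw [Set.indicator_of_mem hy, Set.indicator_of_mem (by simpa using hy.2),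
                  ← mul_assoc]
                refine mul_le_mul_left ?_ _
                -- Hence the kernel is at most `4 L^(-2)`, and the gradient factor `M / L` turns
                -- this into `4M L^(-3)`.
                have hxy : L / 2 ≤ ‖x - y‖ := by
                  have := norm_sub_norm_le y x
                  rw [norm_sub_rev] at this
                  linarith [hy.1]
                refine (mul_le_mul_left (normPow_le_of_nonpos (r := -2) (by norm_num) (by positivity) hxy)
                  _).trans_eq ?_
                rw [← ENNReal.ofReal_mul (by positivity), ← ENNReal.ofReal_mul (by positivity)]
                congr 1
                rw [show (-2 : ℝ) = -((2 : ℕ) : ℝ) by norm_num,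
                  show (-3 : ℝ) = -((3 : ℕ) : ℝ) by norm_num, Real.rpow_neg (by positivity),
                  Real.rpow_neg (by positivity), Real.rpow_natCast, Real.rpow_natCast]
                field_simp
                ring
              · rw [Set.indicator_of_notMem hy]; simp
            · exact hgm.indicator measurableSet_closedBall
  have hc' : ENNReal.ofReal c ≠ 0 := by simpa using hc
  refine ⟨(ENNReal.ofReal c)⁻¹ * (12 * D₁), by
    have := ENNReal.inv_ne_top.2 hc'
    finiteness, ?_⟩
  -- The exceptional null set depends on `L`, so only the countably many values `L = n + 1` are
  -- used.
  have main' : ∀ᵐ x : Space3, ∀ n : ℕ, 2 * r ≤ ‖x‖ → ‖x‖ ≤ ((n : ℝ) + 1) / 2 →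
      ENNReal.ofReal c * ‖g x‖ₑ ≤ 12 * (D₁ * T x + ENNReal.ofReal (4 * M) *
        (ENNReal.ofReal (((n : ℝ) + 1) ^ (-3 : ℝ)) *
          ∫⁻ y in closedBall 0 (2 * ((n : ℝ) + 1)), ‖g y‖ₑ)) :=
    ae_all_iff.2 fun n => main _ (by positivity)
  filter_upwards [main'] with x hx hx1
  have hat : Tendsto (fun n : ℕ => (n : ℝ) + 1) atTop atTop :=
    tendsto_atTop_add_const_right _ _ tendsto_natCast_atTop_atTop
  have lim0 := (tendsto_lintegral_annulus hp hp_top hg).comp hat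
  have lim1 := ENNReal.Tendsto.const_mul (ENNReal.Tendsto.const_mul lim0
    (Or.inr (ENNReal.ofReal_ne_top (r := 4 * M))) |>.const_add (D₁ * T x))
    (Or.inr (by norm_num : (12 : ℝ≥0∞) ≠ ∞))
  rw [mul_zero, add_zero] at lim1
  have key : ENNReal.ofReal c * ‖g x‖ₑ ≤ 12 * (D₁ * T x) := by
    refine ge_of_tendsto lim1 ?_
    filter_upwards [hat.eventually_ge_atTop (2 * ‖x‖)] with n hn
    exact hx n hx1 (by linarith)
  calc ‖g x‖ₑ = (ENNReal.ofReal c)⁻¹ * (ENNReal.ofReal c * ‖g x‖ₑ) := by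
        rw [← mul_assoc, ENNReal.inv_mul_cancel hc' ENNReal.ofReal_ne_top, one_mul]
    _ ≤ (ENNReal.ofReal c)⁻¹ * (12 * (D₁ * T x)) := by gcongr
    _ = _ := by ring

/-! ### Weighted energies and the bootstrap -/

/-- A constant-free Young inequality: compare `t` with `s^(P-2)` and replace the smaller by the
larger. -/
theorem ENNReal.sq_mul_le_rpow_add_rpow {P : ℝ} (hP : 2 < P) (s t : ℝ≥0∞) :
    s ^ 2 * t ≤ s ^ P + t ^ (P / (P - 2)) := by
  have hP2 : 0 < P - 2 := by linarith
  rcases le_total t (s ^ (P - 2)) with h | h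
  · refine le_add_right ?_
    calc s ^ 2 * t ≤ s ^ (2 : ℝ) * s ^ (P - 2) := by rw [ENNReal.rpow_two]; gcongr
      _ = s ^ P := by
        rw [← ENNReal.rpow_add_of_nonneg _ _ zero_le_two hP2.le]; congr 1; ring
  · refine le_add_left ?_
    have h1 : s ≤ t ^ (1 / (P - 2)) := by
      rw [one_div]; exact (ENNReal.le_rpow_inv_iff hP2).2 h
    calc s ^ 2 * t ≤ (t ^ (1 / (P - 2))) ^ 2 * t := by gcongr
      _ = t ^ (1 / (P - 2) * 2) * t ^ (1 : ℝ) := by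
        rw [← ENNReal.rpow_two, ← ENNReal.rpow_mul, ENNReal.rpow_one]
      _ = _ := by
        rw [← ENNReal.rpow_add_of_nonneg _ _ (by positivity) zero_le_one]
        congr 1; field_simp; ring

theorem normPow_le_mul_normPow {s t r : ℝ} (hr : 0 < r) (hst : s ≤ t) {x : Space3} (hx : r ≤ ‖x‖) :
    normPow s x ≤ ENNReal.ofReal (r ^ (s - t)) * normPow t x := by
  have hx0 : 0 < ‖x‖ := hr.trans_le hx
  rw [show s = (s - t) + t by ring, ← normPow_mul _ _ hx0]
  gcongr
  simpa using normPow_le_of_nonpos (sub_nonpos.2 hst) hr hx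

/-- The squared weighted `L²` norm of `g` outside the ball of radius `r`. -/
noncomputable def exteriorEnergy (r : ℝ) (g : Space3 → Spinor) (a : ℝ) : ℝ≥0∞ :=
  ∫⁻ x in {x | r ≤ ‖x‖}, normPow (2 * a) x * ‖g x‖ₑ ^ 2

theorem exteriorEnergy_lt_top_of_memLp {r : ℝ} (hr : 0 < r) {g : Space3 → Spinor} {p : ℝ≥0∞}
    (hp : 2 < p) (hp_top : p ≠ ∞) (hg : MemLp g p volume) :
    ∃ a, -3 / 2 < a ∧ a < 0 ∧ exteriorEnergy r g a < ∞ := by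
  set P := p.toReal with hPdef
  have hP : 2 < P := by
    simpa using (ENNReal.toReal_lt_toReal (by norm_num) hp_top).2 hp
  have hP2 : 0 < P - 2 := by linarith
  -- The conjugate weight `|x|^(2aP/(P-2))` is integrable at infinity when `a < -3(P-2)/(2P)`. The
  -- witness is the midpoint between this threshold and `-3/2`.
  refine ⟨-(3 * (P - 1) / (2 * P)), ?_, ?_, ?_⟩
  · rw [neg_div, neg_lt_neg_iff, div_lt_div_iff₀ (by positivity) (by norm_num)]; linarith
  · rw [neg_lt_zero]
    have : 0 < P - 1 := by linarith
    positivity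
  · set b := 3 * (P - 1) / (P - 2) with hb
    have hb3 : 3 < b := by rw [hb, lt_div_iff₀ hP2]; linarith
    have h1 : ∫⁻ x, ‖g x‖ₑ ^ P < ∞ :=
      lintegral_rpow_enorm_lt_top_of_eLpNorm_lt_top (by positivity) hp_top hg.2
    have h2 := lintegral_normPow_compl_ball_lt_top hb3 hr
    have hpt : ∀ x : Space3, normPow (2 * -(3 * (P - 1) / (2 * P))) x * ‖g x‖ₑ ^ 2 ≤
        ‖g x‖ₑ ^ P + normPow (-b) x := by
      intro x
      rw [mul_comm]
      refine (ENNReal.sq_mul_le_rpow_add_rpow hP _ _).trans_eq ?_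
      congr 1
      unfold normPow
      rw [ENNReal.ofReal_rpow_of_nonneg (by positivity) (by positivity),
        ← Real.rpow_mul (norm_nonneg _)]
      congr 2
      rw [hb]; field_simp
    calc exteriorEnergy r g (-(3 * (P - 1) / (2 * P)))
        ≤ ∫⁻ x in {x | r ≤ ‖x‖}, (‖g x‖ₑ ^ P + normPow (-b) x) := lintegral_mono hpt
      _ = (∫⁻ x in {x | r ≤ ‖x‖}, ‖g x‖ₑ ^ P) + ∫⁻ x in {x | r ≤ ‖x‖}, normPow (-b) x :=
        lintegral_add_right _ (measurable_normPow _)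
      _ < ∞ := ENNReal.add_lt_top.2 ⟨(setLIntegral_le_lintegral _ _).trans_lt h1, h2⟩

/-- On the shell `r ≤ |x| < 2r` local square integrability suffices. Beyond it, the Schur bound for
`f = |y|^(-1-α)|g|` yields the weight exponent `2a' + 2 - 2(1+α) = 2a' - 2α`, which is at most `2a`:
the decay of the potential beyond `|y|^(-1)` is the gain. -/
theorem exteriorEnergy_lt_top_of_le {r α : ℝ} (hr : 0 < r) {g : Space3 → Spinor}
    (hgm : AEStronglyMeasurable g volume) (hloc : ∫⁻ x in closedBall 0 (2 * r), ‖g x‖ₑ ^ 2 < ∞)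
    {D : ℝ≥0∞} (hD : D ≠ ∞) (hrz : ∀ᵐ x : Space3, 2 * r ≤ ‖x‖ → ‖g x‖ₑ ≤
      D * ∫⁻ y in {y | r ≤ ‖y‖}, normPow (-2) (x - y) * (normPow (-1 - α) y * ‖g y‖ₑ))
    {a a' : ℝ} (ha : exteriorEnergy r g a < ∞) (haa' : a' ≤ a + α) (ha'1 : -3 / 2 < a')
    (ha'2 : a' ≤ 0) : exteriorEnergy r g a' < ∞ := by
  obtain ⟨M, hM, hschur⟩ := exists_lintegral_weighted_riesz_le ha'1 (by linarith) hr
  set S : Set Space3 := {x | r ≤ ‖x‖} with hSdef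
  have hS : MeasurableSet S := measurableSet_le_norm r
  set S' : Set Space3 := {x | 2 * r ≤ ‖x‖}
  have hS' : MeasurableSet S' := measurableSet_le_norm (2 * r)
  have hgm' : AEMeasurable (fun y => ‖g y‖ₑ) volume := hgm.enorm
  have near : ∫⁻ x in S \ S', normPow (2 * a') x * ‖g x‖ₑ ^ 2 < ∞ := by
    calc _ ≤ ∫⁻ x in S \ S', ENNReal.ofReal (r ^ (2 * a')) * ‖g x‖ₑ ^ 2 := by
          refine setLIntegral_mono' (hS.diff hS') fun x hx => ?_
          gcongr
          exact normPow_le_of_nonpos (by linarith) hr hx.1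
      _ = ENNReal.ofReal (r ^ (2 * a')) * ∫⁻ x in S \ S', ‖g x‖ₑ ^ 2 :=
          lintegral_const_mul' _ _ ENNReal.ofReal_ne_top
      _ ≤ ENNReal.ofReal (r ^ (2 * a')) * ∫⁻ x in closedBall 0 (2 * r), ‖g x‖ₑ ^ 2 := by
          gcongr
          intro x hx
          have : ¬ 2 * r ≤ ‖x‖ := hx.2
          simp; linarith
      _ < ∞ := ENNReal.mul_lt_top ENNReal.ofReal_lt_top hloc
  have far : ∫⁻ x in S ∩ S', normPow (2 * a') x * ‖g x‖ₑ ^ 2 < ∞ := by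
    calc _ ≤ ∫⁻ x in S ∩ S', D ^ 2 * (normPow (2 * a') x *
          (∫⁻ y in S, normPow (-2) (x - y) * (normPow (-1 - α) y * ‖g y‖ₑ)) ^ 2) := by
          refine lintegral_mono_ae ?_
          filter_upwards [ae_restrict_of_ae hrz, ae_restrict_mem (hS.inter hS')] with x hx hxS
          rw [mul_left_comm, ← mul_pow]
          gcongr
          exact hx hxS.2
      _ = D ^ 2 * ∫⁻ x in S ∩ S', normPow (2 * a') x *
          (∫⁻ y in S, normPow (-2) (x - y) * (normPow (-1 - α) y * ‖g y‖ₑ)) ^ 2 :=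
          lintegral_const_mul' _ _ (by finiteness)
      _ ≤ D ^ 2 * (M * ∫⁻ y in S, normPow (2 * a' + 2) y * (normPow (-1 - α) y * ‖g y‖ₑ) ^ 2) := by
          gcongr
          refine (lintegral_mono_set Set.inter_subset_left).trans (hschur _ ?_)
          fun_prop
      _ ≤ D ^ 2 * (M * ∫⁻ y in S, ENNReal.ofReal (r ^ (2 * a' - 2 * α - 2 * a)) *
          (normPow (2 * a) y * ‖g y‖ₑ ^ 2)) := by
          gcongr D ^ 2 * (M * ?_)
          refine setLIntegral_mono' hS fun y hy => ?_
          rw [mul_pow, ← mul_assoc, normPow_pow_two, normPow_mul _ _ (hr.trans_le hy), ← mul_assoc]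
          gcongr
          rw [show 2 * a' + 2 + 2 * (-1 - α) = 2 * a' - 2 * α by ring]
          exact normPow_le_mul_normPow hr (by linarith) hy
      _ = D ^ 2 * (M * (ENNReal.ofReal (r ^ (2 * a' - 2 * α - 2 * a)) * exteriorEnergy r g a)) := by
          rw [lintegral_const_mul' _ _ ENNReal.ofReal_ne_top]; rfl
      _ < ∞ := by
          have := ha.ne
          exact lt_top_iff_ne_top.2 (by finiteness)
  unfold exteriorEnergy
  rw [← hSdef, ← lintegral_inter_add_sdiff _ S hS']
  exact ENNReal.add_lt_top.2 ⟨far, near⟩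

theorem mainTheorem2
    (A : Space3 → Space3) (α r₁ C : ℝ) (hα : 0 < α) (hr₁ : 0 < r₁)
    (hA : ∀ᵐ x : Space3, r₁ ≤ ‖x‖ → ‖A x‖ ≤ C * ‖x‖ ^ (-1 - α))
    (p : ℝ≥0∞) (hp : 2 ≤ p) (hp_top : p ≠ ∞)
    (g : Space3 → Spinor) (hg_loc : MemW12Loc g) (hg : MemLp g p volume)
    (hsol : SolvesPauliEquation A g) :
    MemLp g 2 volume := by
  rcases hp.eq_or_lt with rfl | hp2
  · exact hg
  have hloc : ∫⁻ x in closedBall 0 (2 * r₁), ‖g x‖ₑ ^ 2 < ∞ := by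
    have := lintegral_rpow_enorm_lt_top_of_eLpNorm_lt_top two_ne_zero ENNReal.ofNat_ne_top
      (hg_loc.1 _ (isCompact_closedBall 0 (2 * r₁))).2
    simpa using this
  obtain ⟨D, hD, hrz⟩ := exists_ae_enorm_le_riesz hα hr₁ hA (one_le_two.trans hp) hp_top hg hsol
  obtain ⟨a, ha1, ha0, hJ⟩ := exteriorEnergy_lt_top_of_memLp hr₁ hp2 hp_top hg
  -- Truncation at `0` keeps every exponent inside the Schur range `(-3/2, 1/2)`.
  have iter : ∀ n : ℕ, exteriorEnergy r₁ g (min 0 (a + n * α)) < ∞ := by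
    intro n
    induction n with
    | zero => simpa [min_eq_right ha0.le] using hJ
    | succ n ih =>
      refine exteriorEnergy_lt_top_of_le hr₁ hg.1 hloc hD hrz ih ?_ ?_ (min_le_left _ _)
      · push_cast
        rcases le_total 0 (a + n * α) with h | h
        · rw [min_eq_left h]; exact (min_le_left _ _).trans (by linarith)
        · rw [min_eq_right h]; exact (min_le_right _ _).trans (by linarith)
      · have : 0 < ((n + 1 : ℕ) : ℝ) * α := by positivity
        exact lt_min (by norm_num) (by linarith)
  obtain ⟨n, hn⟩ := exists_nat_ge (-a / α)
  have hn0 : 0 ≤ a + n * α := by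
    rw [div_le_iff₀ hα] at hn; linarith
  have hfar := iter n
  rw [min_eq_left hn0] at hfar
  have hfar' : ∫⁻ x in {x | r₁ ≤ ‖x‖}, ‖g x‖ₑ ^ 2 < ∞ := by
    simpa [exteriorEnergy, normPow] using hfar
  refine ⟨hg.1, (eLpNorm_lt_top_iff_lintegral_rpow_enorm_lt_top two_ne_zero
    ENNReal.ofNat_ne_top).2 ?_⟩
  simp only [ENNReal.toReal_ofNat, ENNReal.rpow_two]
  rw [← lintegral_add_compl _ (measurableSet_le_norm r₁)]
  refine ENNReal.add_lt_top.2 ⟨hfar', (lintegral_mono_set fun x hx => ?_).trans_lt hloc⟩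
  have : ¬ r₁ ≤ ‖x‖ := hx
  simp; linarith
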